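/- Consider two-party communication protocols in which Alice holds $x\in\mathcal X$, Bob holds $y\in\mathcal Y$, they exchange bits over any number of rounds, and at the end one of the players declares an output in $\{0,1\}$. In a randomized protocol the players' actions may also depend on a common random source; its communication cost is the maximum, over the inputs and the values of the random source, of the total number of bits sent. For $f\colon\mathcal X\times\mathcal Y\to\{0,1\}$ and $\delta>0$ let $R_\delta(f)$ be the minimum cost of a randomized protocol which, on every input $(x,y)$, outputs a value different from $f(x,y)$ with probability at most $\delta$. Let $\mathrm{Ham}^n_k\colon\{0,1\}^n\times\{0,1\}^n\to\{0,1\}$ be the $k$-Hamming distance problem: $\mathrm{Ham}^n_k(x,y)=1$ if and only if $x$ and $y$ differ in at most $k$ positions. Theorem. For every $\delta_0<1/2$ there is a constant $c>0$, depending only on $\delta_0$, such that for all integers $n,k\ge 0$ and all real $\delta$ with $0<\delta\le\delta_0$ and $k^2\le\delta n$, $$R_\delta(\mathrm{Ham}^n_k)\ \ge\ c\,k\log(1/\delta).$$ The same lower bound holds for the cost of randomized protocols that are only required to err with probability at most $\delta$ on the inputs $(x,y)$ whose Hamming distance is exactly $k$ or exactly $k+2$, and that may output an arbitrary answer on all other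 inputs. -/

import Mathlib

open MeasureTheory

/-- A deterministic two-party communication protocol, as a protocol tree. At a `send` node the
owner of the node sends one bit, a function of the owner's input, and both players continue in the
subtree selected by this bit (a longer message is a run of consecutive nodes of one player). At
an `out` leaf the communication is over and one of the players declares the output, which may
depend on the input of that player. -/
inductive CommTree (X Y : Type) : Type where
  | aliceOut (f : X → Bool) : CommTree X Y
  | bobOut (g : Y → Bool) : CommTree X Y
  | aliceSend (f : X → Bool) (next : Bool → CommTree X Y) : CommTree X Y
  | bobSend (g : Y → Bool) (next : Bool → CommTree X Y) : CommTree X Y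

namespace CommTree

variable {X Y : Type}

/-- The output of the protocol when Alice holds `x` and Bob holds `y`. -/
def run : CommTree X Y → X → Y → Bool
  | aliceOut f, x, _ => f x
  | bobOut g, _, y => g y
  | aliceSend f next, x, y => (next (f x)).run x y
  | bobSend g next, x, y => (next (g y)).run x y

/-- The total number of bits sent when Alice holds `x` and Bob holds `y`. -/
def bitsSent : CommTree X Y → X → Y → ℕ
  | aliceOut _, _, _ => 0
  | bobOut _, _, _ => 0
  | aliceSend f next, x, y => (next (f x)).bitsSent x y + 1
  | bobSend g next, x, y => (next (g y)).bitsSent x y + 1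

end CommTree

/-- A randomized (public-coin) protocol: a common random source, and a deterministic protocol for
each of its values, such that the output on every input is a random variable. There is no bound
on the number of rounds. -/
structure RandProtocol (X Y : Type) where
  /-- the values of the common random source -/
  Ω : Type
  /-- the events -/
  mΩ : MeasurableSpace Ω
  /-- the law of the random source -/
  μ : Measure Ω
  /-- the law is a probability measure -/
  isProb : IsProbabilityMeasure μ
  /-- the deterministic protocol that is followed for a given value of the source -/
  tree : Ω → CommTree X Y
  /-- the output on each input is a random variable -/
  measurableSet_run : ∀ x y, MeasurableSet {ω | (tree ω).run x y = true}

namespace RandProtocol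

variable {X Y : Type}

/-- The communication cost: the maximum, over the inputs and the random source, of the total
number of bits sent (`⊤` if unbounded). -/
noncomputable def cost (P : RandProtocol X Y) : ℕ∞ :=
  ⨆ (ω : P.Ω) (x : X) (y : Y), ((P.tree ω).bitsSent x y : ℕ∞)

/-- The probability that the output on input `(x, y)` differs from `f x y`. -/
noncomputable def errorProb (P : RandProtocol X Y) (f : X → Y → Bool) (x : X) (y : Y) : ℝ :=
  (@Measure.real P.Ω P.mΩ P.μ {ω | (P.tree ω).run x y ≠ f x y})

end RandProtocol

/-- The `δ`-error randomized communication complexity of the function `f` under the promise that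
the input lies in `D`: the minimum cost of a randomized protocol that errs with probability at
most `δ` on every input in `D`, and may answer arbitrarily on all other inputs. -/
noncomputable def randCCOn {X Y : Type} (D : Set (X × Y)) (δ : ℝ) (f : X → Y → Bool) : ℕ∞ :=
  ⨅ (P : RandProtocol X Y) (_ : ∀ x y, (x, y) ∈ D → P.errorProb f x y ≤ δ), P.cost

/-- The `δ`-error randomized communication complexity `R_δ(f)` of `f`. -/
noncomputable def randCC {X Y : Type} (δ : ℝ) (f : X → Y → Bool) : ℕ∞ :=
  randCCOn Set.univ δ f

/-- The `k`-Hamming distance problem on strings of length `n`: the answer is `1` if and only if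
`x` and `y` differ in at most `k` positions. -/
def hamProblem (n k : ℕ) (x y : Fin n → Bool) : Bool :=
  decide (hammingDist x y ≤ k)

/-- The pairs of strings of length `n` at Hamming distance exactly `k` or exactly `k + 2`. -/
def hamPromise (n k : ℕ) : Set ((Fin n → Bool) × (Fin n → Bool)) :=
  {p | hammingDist p.1 p.2 = k ∨ hammingDist p.1 p.2 = k + 2}

/-
Fix a set `I` of coordinates. Alice takes a uniformly random `x`, and Bob the endpoint of a random
walk from `x` that flips in each step a random coordinate of `I`. After `m` steps the walk is at
distance `m` except with probability about `m ^ 2 / (2 * #I)`, so if Bob complements his string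
outside `I`, where `#Iᶜ = k - m`, the inputs are at distance `k` after `m` steps and at distance
`k + 2` after `m + 2` steps. A protocol of cost `C` is a random sum of `2 ^ C` rectangles, and for
each rectangle the inequality of Blakley and Dixon,
`⟨u, S ^ m v⟩ ^ (m + 2) ≤ ⟨u, S ^ (m + 2) v⟩ ^ m * (⟨u, u⟩ * ⟨v, v⟩)`, bounds the chance of hitting
it after `m` steps by the chance after `m + 2` steps. Summed over the rectangles this gives
`(1 - η) ^ (m + 2) ≤ η ^ m * 2 ^ C`, where `η` is `δ` plus the failure probability of the walk. For
small `δ` take `m = k`; when `δ` is close to `1 / 2`, take `m = ⌊k / M⌋` with `M` so large that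
`η < 1 / 2`.
-/

open scoped BigOperators

theorem sum_mul_log_div_le {α : Type*} (s : Finset α) {p q : α → ℝ} (hp : ∀ i ∈ s, 0 ≤ p i)
    (hq : ∀ i ∈ s, 0 ≤ q i) (hpq : ∀ i ∈ s, q i = 0 → p i = 0) :
    (∑ i ∈ s, p i) * Real.log ((∑ i ∈ s, p i) / ∑ i ∈ s, q i) ≤
      ∑ i ∈ s, p i * Real.log (p i / q i) := by
  rcases (Finset.sum_nonneg hq).eq_or_lt with hQ | hQ
  · have hp0 : ∀ i ∈ s, p i = 0 := fun i hi =>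
      hpq i hi ((Finset.sum_eq_zero_iff_of_nonneg hq).mp hQ.symm i hi)
    rw [Finset.sum_eq_zero hp0, zero_mul, Finset.sum_eq_zero fun i hi => by rw [hp0 i hi, zero_mul]]
  · have hcancel : ∀ i ∈ s, q i * (p i / q i) = p i := fun i hi =>
      mul_div_cancel_of_imp' (hpq i hi)
    have jensen := Real.convexOn_mul_log.map_centerMass_le (t := s) (w := q)
      (p := fun i => p i / q i) hq hQ fun i hi => div_nonneg (hp i hi) (hq i hi)
    simp only [Finset.centerMass, smul_eq_mul, Function.comp_apply, ← mul_assoc] at jensen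
    have hlog : ∑ i ∈ s, q i * (p i / q i) * Real.log (p i / q i) =
        ∑ i ∈ s, p i * Real.log (p i / q i) :=
      Finset.sum_congr rfl fun i hi => by rw [hcancel i hi]
    rwa [Finset.sum_congr rfl hcancel, hlog, mul_assoc, mul_le_mul_iff_right₀ (inv_pos.mpr hQ),
      inv_mul_eq_div] at jensen

theorem add_two_mul_le_of_pow_le {k : ℕ} {a b c d : ℝ} (hb : 0 ≤ b) (hc : 0 ≤ c) (hd : 0 ≤ d)
    (h : a ^ (k + 2) ≤ b ^ k * c * d) : (k + 2) * a ≤ k * b + c + d := by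
  have hk : (0 : ℝ) < k + 2 := by positivity
  have geom_le :
      a ≤ b ^ ((k : ℝ) / (k + 2)) * c ^ (1 / ((k : ℝ) + 2)) * d ^ (1 / ((k : ℝ) + 2)) := by
    refine le_of_pow_le_pow_left₀ (n := k + 2) (by omega) (by positivity) (h.trans_eq ?_)
    rw [mul_pow, mul_pow, ← Real.rpow_mul_natCast hb, ← Real.rpow_mul_natCast hc,
      ← Real.rpow_mul_natCast hd]
    push_cast
    rw [div_mul_cancel₀ _ hk.ne', div_mul_cancel₀ _ hk.ne', Real.rpow_natCast, Real.rpow_one,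
      Real.rpow_one]
  have mean_le := geom_le.trans (Real.geom_mean_le_arith_mean3_weighted (by positivity)
    (by positivity) (by positivity) hb hc hd (by field_simp; ring))
  calc (k + 2) * a ≤ (k + 2) * (k / (k + 2) * b + 1 / (k + 2) * c + 1 / (k + 2) * d) := by gcongr
    _ = k * b + c + d := by field_simp

section BlakleyDixon

open Matrix

variable {V W : Type*}

section Nonneg

variable [Fintype W] {A : Matrix V W ℝ} (hA : ∀ i j, 0 ≤ A i j) {f : W → ℝ} (hf : 0 ≤ f)

include hA hf

theorem mulVec_nonneg : 0 ≤ A *ᵥ f :=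
  fun i => Finset.sum_nonneg fun j _ => mul_nonneg (hA i j) (hf j)

theorem mulVec_apply_pos {i : V} {j : W} (hij : 0 < A i j) (hj : 0 < f j) : 0 < (A *ᵥ f) i :=
  Finset.sum_pos' (fun j _ => mul_nonneg (hA i j) (hf j)) ⟨j, Finset.mem_univ j, mul_pos hij hj⟩

end Nonneg

variable [Fintype V]

/-- The sum of `f g log (f / g)`. It is the potential whose increments along the walk prove the
Blakley–Dixon inequality; terms with `f x = 0` or `g x = 0` vanish. -/
noncomputable def logRatioSum (f g : V → ℝ) : ℝ :=
  ∑ x, f x * g x * Real.log (f x / g x)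

theorem logRatioSum_swap (f g : V → ℝ) : logRatioSum g f = -logRatioSum f g := by
  simp only [logRatioSum, ← Finset.sum_neg_distrib]
  refine Finset.sum_congr rfl fun x _ => ?_
  rw [← inv_div, Real.log_inv, mul_comm (g x), mul_neg]

theorem dotProduct_mul_log_le_logRatioSum {f g : V → ℝ} (hf : 0 ≤ f) (hg : 0 ≤ g) :
    (f ⬝ᵥ g) * Real.log ((f ⬝ᵥ g) / (g ⬝ᵥ g)) ≤ logRatioSum f g := by
  refine (sum_mul_log_div_le Finset.univ (p := fun x => f x * g x) (q := fun x => g x * g x)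
    (fun x _ => mul_nonneg (hf x) (hg x)) (fun x _ => mul_nonneg (hg x) (hg x))
    fun x _ h => by simp [mul_self_eq_zero.mp h]).trans_eq (Finset.sum_congr rfl fun x _ => ?_)
  rcases eq_or_ne (g x) 0 with h | h
  · simp [h]
  · rw [mul_div_mul_right _ _ h]

theorem sum_mul_mul_eq_dotProduct_mulVec [Fintype W] (A : Matrix V W ℝ) (f : V → ℝ) (g : W → ℝ) :
    ∑ e : V × W, f e.1 * A e.1 e.2 * g e.2 = f ⬝ᵥ A *ᵥ g := by
  simp only [Fintype.sum_prod_type, dotProduct, mulVec, Finset.mul_sum, mul_assoc]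

theorem vecMul_nonneg {A : Matrix V W ℝ} (hA : ∀ i j, 0 ≤ A i j) {f : V → ℝ} (hf : 0 ≤ f) :
    0 ≤ f ᵥ* A :=
  fun j => Finset.sum_nonneg fun i _ => mul_nonneg (hf i) (hA i j)

section Edge

variable [Fintype W] {A : Matrix V W ℝ} (hA : ∀ i j, 0 ≤ A i j) {f : V → ℝ} {g : W → ℝ} (hf : 0 ≤ f)
  (hg : 0 ≤ g)

include hA hf hg

theorem pos_of_mul_mul_ne_zero {x : V} {y : W} (h : f x * A x y * g y ≠ 0) :
    0 < f x ∧ 0 < A x y ∧ 0 < g y ∧ 0 < (f ᵥ* A) y ∧ 0 < (A *ᵥ g) x := by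
  have hfx : 0 < f x := (hf x).lt_of_ne' (left_ne_zero_of_mul (left_ne_zero_of_mul h))
  have hAxy : 0 < A x y := (hA x y).lt_of_ne' (right_ne_zero_of_mul (left_ne_zero_of_mul h))
  have hgy : 0 < g y := (hg y).lt_of_ne' (right_ne_zero_of_mul h)
  refine ⟨hfx, hAxy, hgy, ?_, mulVec_apply_pos hA hg hAxy hgy⟩
  rw [← mulVec_transpose]
  exact mulVec_apply_pos (fun j i => hA i j) hf hAxy hfx

theorem dotProduct_mulVec_vecMul_pos (h : f ⬝ᵥ A *ᵥ g ≠ 0) :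
    0 < (A *ᵥ g) ⬝ᵥ A *ᵥ (f ᵥ* A) := by
  rw [← sum_mul_mul_eq_dotProduct_mulVec] at h ⊢
  obtain ⟨e, -, he⟩ := Finset.exists_ne_zero_of_sum_ne_zero h
  obtain ⟨-, hAe, -, hfA, hAg⟩ := pos_of_mul_mul_ne_zero hA hf hg he
  exact Finset.sum_pos' (fun e _ => mul_nonneg (mul_nonneg (mulVec_nonneg hA hg e.1) (hA _ _))
    (vecMul_nonneg hA hf e.2)) ⟨e, Finset.mem_univ e, mul_pos (mul_pos hAg hAe) hfA⟩

/- The log-sum inequality over the edges `(x, y)`, comparing the weights `f x * A x y * g y` and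
`(A *ᵥ g) x * A x y * (f ᵥ* A) y`. -/
theorem dotProduct_mulVec_mul_log_le_logRatioSum_sub :
    (f ⬝ᵥ A *ᵥ g) * Real.log ((f ⬝ᵥ A *ᵥ g) / ((A *ᵥ g) ⬝ᵥ A *ᵥ (f ᵥ* A))) ≤
      logRatioSum f (A *ᵥ g) - logRatioSum (f ᵥ* A) g := by
  have hAg : 0 ≤ A *ᵥ g := mulVec_nonneg hA hg
  have hfA : 0 ≤ f ᵥ* A := vecMul_nonneg hA hf
  have logSum := sum_mul_log_div_le Finset.univ (p := fun e : V × W => f e.1 * A e.1 e.2 * g e.2)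
    (q := fun e : V × W => (A *ᵥ g) e.1 * A e.1 e.2 * (f ᵥ* A) e.2)
    (fun e _ => mul_nonneg (mul_nonneg (hf _) (hA _ _)) (hg _))
    (fun e _ => mul_nonneg (mul_nonneg (hAg _) (hA _ _)) (hfA _)) fun e _ hq => by
      by_contra hp
      obtain ⟨-, hAe, -, hfAe, hAge⟩ := pos_of_mul_mul_ne_zero hA hf hg hp
      exact (mul_pos (mul_pos hAge hAe) hfAe).ne' hq
  rw [sum_mul_mul_eq_dotProduct_mulVec, sum_mul_mul_eq_dotProduct_mulVec] at logSum
  have split : ∀ x y, f x * A x y * g y *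
        Real.log (f x * A x y * g y / ((A *ᵥ g) x * A x y * (f ᵥ* A) y)) =
      f x * (A x y * g y) * Real.log (f x / (A *ᵥ g) x) -
        f x * A x y * g y * Real.log ((f ᵥ* A) y / g y) := by
    intro x y
    rw [← mul_assoc, ← mul_sub]
    rcases eq_or_ne (f x * A x y * g y) 0 with h0 | h0
    · rw [h0, zero_mul, zero_mul]
    · obtain ⟨hfx, hAxy, hgy, hfAy, hAgx⟩ := pos_of_mul_mul_ne_zero hA hf hg h0
      rw [← Real.log_div (by positivity) (by positivity)]
      congr 2
      field_simp
  refine logSum.trans_eq ?_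
  simp only [split, Finset.sum_sub_distrib, logRatioSum]
  congr 1
  · simp only [Fintype.sum_prod_type, ← Finset.sum_mul, ← Finset.mul_sum]
    rfl
  · simp only [Fintype.sum_prod_type_right, ← Finset.sum_mul]
    rfl

end Edge

variable [DecidableEq V]

theorem pow_mulVec_nonneg {S : Matrix V V ℝ} (hS₀ : ∀ i j, 0 ≤ S i j) {f : V → ℝ} (hf : 0 ≤ f)
    (k : ℕ) : 0 ≤ S ^ k *ᵥ f := by
  induction k with
  | zero => simpa using hf
  | succ k ih =>
    rw [pow_succ', ← mulVec_mulVec]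
    exact mulVec_nonneg hS₀ ih

theorem pow_mulVec_dotProduct_pow_mulVec {S : Matrix V V ℝ} (hS : S.IsSymm) (u v : V → ℝ)
    (i j : ℕ) : (S ^ i *ᵥ u) ⬝ᵥ (S ^ j *ᵥ v) = u ⬝ᵥ S ^ (i + j) *ᵥ v := by
  rw [pow_add, ← mulVec_mulVec, dotProduct_mulVec u, ← mulVec_transpose, transpose_pow, hS.eq]

section Walk

variable {S : Matrix V V ℝ} (hS : S.IsSymm) (hS₀ : ∀ i j, 0 ≤ S i j) {u v : V → ℝ}
  (hu : 0 ≤ u) (hv : 0 ≤ v)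

include hS hS₀ hu hv

theorem dotProduct_pow_add_two_mulVec_pos {k : ℕ} (hk : k ≠ 0) (h : 0 < u ⬝ᵥ S ^ k *ᵥ v) :
    0 < u ⬝ᵥ S ^ (k + 2) *ᵥ v := by
  obtain ⟨j, rfl⟩ := Nat.exists_eq_add_one_of_ne_zero hk
  rw [pow_succ', ← mulVec_mulVec] at h
  have hpos := dotProduct_mulVec_vecMul_pos hS₀ hu (pow_mulVec_nonneg hS₀ hv j) h.ne'
  rw [dotProduct_comm, ← mulVec_transpose, hS.eq, mulVec_mulVec, mulVec_mulVec, ← pow_succ',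
    ← sq, pow_mulVec_dotProduct_pow_mulVec hS] at hpos
  rwa [show j + 1 + 2 = 2 + (j + 1) by omega]

theorem mul_log_le_logRatioSum_pow_sub (i j : ℕ) :
    (u ⬝ᵥ S ^ (i + j + 1) *ᵥ v) *
        Real.log ((u ⬝ᵥ S ^ (i + j + 1) *ᵥ v) / (u ⬝ᵥ S ^ (i + j + 1 + 2) *ᵥ v)) ≤
      logRatioSum (S ^ i *ᵥ u) (S ^ (j + 1) *ᵥ v) -
        logRatioSum (S ^ (i + 1) *ᵥ u) (S ^ j *ᵥ v) := by
  have mulVec_pow (w : V → ℝ) (m : ℕ) : S *ᵥ S ^ m *ᵥ w = S ^ (m + 1) *ᵥ w := by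
    rw [mulVec_mulVec, ← pow_succ']
  have edge := dotProduct_mulVec_mul_log_le_logRatioSum_sub hS₀ (pow_mulVec_nonneg hS₀ hu i)
    (pow_mulVec_nonneg hS₀ hv j)
  rw [← mulVec_transpose, hS.eq, mulVec_pow, mulVec_pow, mulVec_pow,
    pow_mulVec_dotProduct_pow_mulVec hS, dotProduct_comm (S ^ (j + 1) *ᵥ v),
    pow_mulVec_dotProduct_pow_mulVec hS] at edge
  rwa [show i + 1 + 1 + (j + 1) = i + j + 1 + 2 by omega] at edge

theorem natCast_mul_log_le_logRatioSum_sub (k : ℕ) :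
    k * ((u ⬝ᵥ S ^ k *ᵥ v) * Real.log ((u ⬝ᵥ S ^ k *ᵥ v) / (u ⬝ᵥ S ^ (k + 2) *ᵥ v))) ≤
      logRatioSum u (S ^ k *ᵥ v) - logRatioSum (S ^ k *ᵥ u) v := by
  have telescope := Finset.sum_range_sub'
    (fun j => logRatioSum (S ^ j *ᵥ u) (S ^ (k - j) *ᵥ v)) k
  simp only [pow_zero, one_mulVec, Nat.sub_zero, Nat.sub_self] at telescope
  rw [← telescope, ← nsmul_eq_mul, ← Finset.card_range k, ← Finset.sum_const, Finset.card_range]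
  refine Finset.sum_le_sum fun i hi => ?_
  obtain ⟨j, rfl⟩ := Nat.exists_eq_add_of_lt (Finset.mem_range.mp hi)
  rw [show i + j + 1 - i = j + 1 by omega, show i + j + 1 - (i + 1) = j by omega]
  exact mul_log_le_logRatioSum_pow_sub hS hS₀ hu hv i j

theorem dotProduct_pow_mulVec_mul_log_sum_nonpos (k : ℕ) :
    (u ⬝ᵥ S ^ k *ᵥ v) * (k * Real.log ((u ⬝ᵥ S ^ k *ᵥ v) / (u ⬝ᵥ S ^ (k + 2) *ᵥ v)) +
      Real.log ((u ⬝ᵥ S ^ k *ᵥ v) / (u ⬝ᵥ u)) + Real.log ((u ⬝ᵥ S ^ k *ᵥ v) / (v ⬝ᵥ v))) ≤ 0 := by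
  have walk := natCast_mul_log_le_logRatioSum_sub hS hS₀ hu hv k
  have atStart := dotProduct_mul_log_le_logRatioSum (pow_mulVec_nonneg hS₀ hv k) hu
  have atEnd := dotProduct_mul_log_le_logRatioSum (pow_mulVec_nonneg hS₀ hu k) hv
  rw [logRatioSum_swap, dotProduct_comm] at atStart
  rw [show (S ^ k *ᵥ u) ⬝ᵥ v = u ⬝ᵥ S ^ k *ᵥ v by
    simpa using pow_mulVec_dotProduct_pow_mulVec hS u v k 0] at atEnd
  linarith

/- The inequality of Blakley and Dixon, for symmetric matrices with nonnegative entries. -/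
theorem dotProduct_pow_mulVec_pow_le (k : ℕ) :
    (u ⬝ᵥ S ^ k *ᵥ v) ^ (k + 2) ≤ (u ⬝ᵥ S ^ (k + 2) *ᵥ v) ^ k * ((u ⬝ᵥ u) * (v ⬝ᵥ v)) := by
  have hu₂ : 0 ≤ u ⬝ᵥ u := dotProduct_nonneg_of_nonneg hu hu
  have hv₂ : 0 ≤ v ⬝ᵥ v := dotProduct_nonneg_of_nonneg hv hv
  have hab (j : ℕ) : 0 ≤ u ⬝ᵥ S ^ j *ᵥ v :=
    dotProduct_nonneg_of_nonneg hu (pow_mulVec_nonneg hS₀ hv j)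
  rcases eq_or_ne k 0 with rfl | hk
  · simpa [dotProduct, sq] using Finset.sum_mul_sq_le_sq_mul_sq Finset.univ u v
  rcases (hab k).eq_or_lt with ha | ha
  · rw [← ha, zero_pow (by omega)]
    exact mul_nonneg (pow_nonneg (hab (k + 2)) k) (mul_nonneg hu₂ hv₂)
  have hb := dotProduct_pow_add_two_mulVec_pos hS hS₀ hu hv hk ha
  have hu₂ : 0 < u ⬝ᵥ u := hu₂.lt_of_ne' fun h => by
    rw [dotProduct_self_eq_zero.mp h, zero_dotProduct] at ha; exact ha.false
  have hv₂ : 0 < v ⬝ᵥ v := hv₂.lt_of_ne' fun h => by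
    rw [dotProduct_self_eq_zero.mp h, mulVec_zero, dotProduct_zero] at ha; exact ha.false
  have hlog := nonpos_of_mul_nonpos_right
    (dotProduct_pow_mulVec_mul_log_sum_nonpos hS hS₀ hu hv k) ha
  rw [Real.log_div ha.ne' hb.ne', Real.log_div ha.ne' hu₂.ne', Real.log_div ha.ne' hv₂.ne'] at hlog
  rw [← Real.log_le_log_iff (by positivity) (by positivity), Real.log_mul (by positivity)
    (by positivity), Real.log_mul (by positivity) (by positivity), Real.log_pow, Real.log_pow]
  push_cast
  linarith

end Walk

end BlakleyDixon

section WalkMean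

open Matrix

variable {V : Type*} [Fintype V]

/-- The mean of `F` over the endpoints of one step of the walk with transition matrix `S`, started
from a uniformly distributed vertex. -/
noncomputable def walkMean (S : Matrix V V ℝ) (F : V → V → ℝ) : ℝ :=
  𝔼 x, (S *ᵥ F x) x

theorem walkMean_mul (S : Matrix V V ℝ) (u v : V → ℝ) :
    walkMean S (fun x y => u x * v y) = (u ⬝ᵥ S *ᵥ v) / Fintype.card V := by
  simp only [walkMean, Fintype.expect_eq_sum_div_card, dotProduct, mulVec, Finset.mul_sum,
    mul_left_comm]

theorem walkMean_sum {ι : Type*} (s : Finset ι) (S : Matrix V V ℝ) (F : ι → V → V → ℝ) :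
    walkMean S (fun x y => ∑ i ∈ s, F i x y) = ∑ i ∈ s, walkMean S (F i) := by
  simp only [walkMean, mulVec, dotProduct, Finset.mul_sum]
  rw [← Finset.expect_sum_comm]
  exact Finset.expect_congr rfl fun x _ => Finset.sum_comm

theorem walkMean_one_sub [Nonempty V] {S : Matrix V V ℝ} (hS : S *ᵥ 1 = 1) (F : V → V → ℝ) :
    walkMean S (fun x y => 1 - F x y) = 1 - walkMean S F := by
  have step (x : V) : (S *ᵥ fun y => 1 - F x y) x = 1 - (S *ᵥ F x) x := by
    change (S *ᵥ (1 - F x)) x = _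
    rw [mulVec_sub, hS, Pi.sub_apply, Pi.one_apply]
  simp only [walkMean, step]
  rw [Finset.expect_sub_distrib, Finset.expect_const Finset.univ_nonempty]

theorem walkMean_nonneg {S : Matrix V V ℝ} (hS : ∀ i j, 0 ≤ S i j) {F : V → V → ℝ}
    (hF : 0 ≤ F) : 0 ≤ walkMean S F :=
  Finset.expect_nonneg fun x _ => mulVec_nonneg hS (hF x) x

theorem walkMean_integral {Ω : Type*} [MeasurableSpace Ω] {μ : Measure Ω} (S : Matrix V V ℝ)
    {F : Ω → V → V → ℝ} (hF : ∀ x y, Integrable (fun ω => F ω x y) μ) :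
    ∫ ω, walkMean S (F ω) ∂μ = walkMean S (fun x y => ∫ ω, F ω x y ∂μ) := by
  have term_integrable (x y : V) := (hF x y).const_mul (S x y)
  simp only [walkMean, Fintype.expect_eq_sum_div_card, mulVec, dotProduct]
  rw [integral_div, integral_finsetSum _ fun x _ =>
    integrable_finsetSum _ fun y _ => term_integrable x y]
  simp only [integral_finsetSum _ fun y _ => term_integrable _ y, integral_const_mul]

theorem integrable_walkMean {Ω : Type*} [MeasurableSpace Ω] {μ : Measure Ω} (S : Matrix V V ℝ)
    {F : Ω → V → V → ℝ} (hF : ∀ x y, Integrable (fun ω => F ω x y) μ) :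
    Integrable (fun ω => walkMean S (F ω)) μ := by
  simp only [walkMean, Fintype.expect_eq_sum_div_card, mulVec, dotProduct]
  exact (integrable_finsetSum _ fun x _ =>
    integrable_finsetSum _ fun y _ => (hF x y).const_mul _).div_const _

theorem walkMean_mul_pow_le [DecidableEq V] {S : Matrix V V ℝ} (hS : S.IsSymm)
    (hS₀ : ∀ i j, 0 ≤ S i j) {u v : V → ℝ} (hu : 0 ≤ u) (hv : 0 ≤ v) (k : ℕ) :
    walkMean (S ^ k) (fun x y => u x * v y) ^ (k + 2) ≤
      walkMean (S ^ (k + 2)) (fun x y => u x * v y) ^ k *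
        ((𝔼 x, u x * u x) * 𝔼 y, v y * v y) := by
  simp only [walkMean_mul, Fintype.expect_eq_sum_div_card]
  change _ ≤ _ * ((u ⬝ᵥ u) / _ * ((v ⬝ᵥ v) / _))
  calc ((u ⬝ᵥ S ^ k *ᵥ v) / Fintype.card V) ^ (k + 2)
      = (u ⬝ᵥ S ^ k *ᵥ v) ^ (k + 2) / (Fintype.card V : ℝ) ^ (k + 2) := div_pow _ _ _
    _ ≤ (u ⬝ᵥ S ^ (k + 2) *ᵥ v) ^ k * ((u ⬝ᵥ u) * (v ⬝ᵥ v)) / (Fintype.card V : ℝ) ^ (k + 2) := by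
      gcongr
      exact dotProduct_pow_mulVec_pow_le hS hS₀ hu hv k
    _ = _ := by rw [div_pow, pow_add (Fintype.card V : ℝ), sq, div_mul_div_comm, div_mul_div_comm]

end WalkMean

/-- `F` is a sum of indicator functions of `N` combinatorial rectangles, some of which may be
empty. -/
def IsRectangleSum {X Y : Type*} (N : ℕ) (F : X → Y → ℝ) : Prop :=
  ∃ (R : Fin N → Set X) (Q : Fin N → Set Y),
    ∀ x y, F x y = ∑ i, (R i).indicator 1 x * (Q i).indicator 1 y

namespace IsRectangleSum

variable {X Y : Type*} {N M : ℕ} {F G : X → Y → ℝ}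

theorem nonneg (hF : IsRectangleSum N F) : 0 ≤ F := by
  obtain ⟨R, Q, h⟩ := hF
  intro x y
  rw [h]
  exact Finset.sum_nonneg fun i _ => mul_nonneg (Set.indicator_nonneg (fun _ _ => zero_le_one) _)
    (Set.indicator_nonneg (fun _ _ => zero_le_one) _)

theorem indicator_mul_indicator (R : Set X) (Q : Set Y) :
    IsRectangleSum 1 fun x y => R.indicator 1 x * Q.indicator 1 y :=
  ⟨fun _ => R, fun _ => Q, fun x y => by simp⟩

theorem zero (N : ℕ) : IsRectangleSum N (0 : X → Y → ℝ) :=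
  ⟨fun _ => ∅, fun _ => ∅, fun x y => by simp⟩

theorem add (hF : IsRectangleSum N F) (hG : IsRectangleSum M G) :
    IsRectangleSum (N + M) (F + G) := by
  obtain ⟨R, Q, h⟩ := hF
  obtain ⟨R', Q', h'⟩ := hG
  exact ⟨Fin.append R R', Fin.append Q Q', fun x y => by
    simp only [Pi.add_apply, h, h', Fin.sum_univ_add, Fin.append_left, Fin.append_right]⟩

theorem mono (hF : IsRectangleSum N F) (h : N ≤ M) : IsRectangleSum M F := by
  obtain ⟨d, rfl⟩ := Nat.exists_eq_add_of_le h
  simpa using hF.add (zero d)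

theorem comp {X' Y' : Type*} (hF : IsRectangleSum N F) (φ : X' → X) (ψ : Y' → Y) :
    IsRectangleSum N fun x y => F (φ x) (ψ y) := by
  obtain ⟨R, Q, h⟩ := hF
  exact ⟨fun i => φ ⁻¹' R i, fun i => ψ ⁻¹' Q i, fun x y => h (φ x) (ψ y)⟩

end IsRectangleSum

section RectangleBound

open Matrix

variable {V : Type*} [Fintype V] [DecidableEq V] {S : Matrix V V ℝ} (hS : S.IsSymm)
  (hS₀ : ∀ i j, 0 ≤ S i j) {N k : ℕ} {q θ : ℝ}

include hS hS₀

theorem walkMean_rectangle_le (hq : 0 < q) (hθ : 0 < θ) (hθq : θ ^ (k + 2) = q ^ k * N)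
    (R Q : Set V) :
    (k + 2) * walkMean (S ^ k) (fun x y => R.indicator 1 x * Q.indicator 1 y) ≤
      θ * (k * (walkMean (S ^ (k + 2)) (fun x y => R.indicator 1 x * Q.indicator 1 y) / q) +
        (𝔼 x, R.indicator 1 x) * (𝔼 y, Q.indicator 1 y) + 1 / N) := by
  have ind_nonneg (R : Set V) : (0 : V → ℝ) ≤ R.indicator 1 :=
    Set.indicator_nonneg fun _ _ => zero_le_one
  have ind_mul_self (R : Set V) (x : V) :
      (R.indicator 1 x : ℝ) * R.indicator 1 x = R.indicator 1 x := by
    by_cases hx : x ∈ R <;> simp [hx]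
  have walk := walkMean_mul_pow_le hS hS₀ (ind_nonneg R) (ind_nonneg Q) k
  simp only [ind_mul_self] at walk
  have walk_nonneg : 0 ≤ walkMean (S ^ (k + 2))
      (fun x y => R.indicator (1 : V → ℝ) x * Q.indicator (1 : V → ℝ) y) := by
    rw [walkMean_mul]
    exact div_nonneg (dotProduct_nonneg_of_nonneg (ind_nonneg R)
      (pow_mulVec_nonneg hS₀ (ind_nonneg Q) _)) (Nat.cast_nonneg _)
  rw [← div_le_iff₀' hθ, mul_div_assoc]
  refine add_two_mul_le_of_pow_le (by positivity) (mul_nonneg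
    (Finset.expect_nonneg fun x _ => ind_nonneg R x)
    (Finset.expect_nonneg fun y _ => ind_nonneg Q y)) (by positivity) ?_
  calc _ = walkMean (S ^ k) (fun x y => R.indicator (1 : V → ℝ) x * Q.indicator (1 : V → ℝ) y)
        ^ (k + 2) / (q ^ k * N) := by rw [div_pow, hθq]
    _ ≤ _ := div_le_div_of_nonneg_right walk (by positivity)
    _ = _ := by rw [div_pow]; ring

theorem IsRectangleSum.walkMean_le [Nonempty V] {F : V → V → ℝ} (hF : IsRectangleSum N F)
    (hF₁ : ∀ x y, F x y ≤ 1) (hq : 0 < q) (hθ : 0 < θ) (hθq : θ ^ (k + 2) = q ^ k * N) :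
    (k + 2) * walkMean (S ^ k) F ≤ θ * (k * (walkMean (S ^ (k + 2)) F / q) + 2) := by
  have hN : (N : ℝ) ≠ 0 := fun h => (pow_pos hθ (k + 2)).ne' (by rw [hθq, h, mul_zero])
  obtain ⟨R, Q, hRQ⟩ := hF
  have density_le : ∑ i, (𝔼 x, (R i).indicator (1 : V → ℝ) x) *
      (𝔼 y, (Q i).indicator (1 : V → ℝ) y) ≤ 1 := by
    simp only [Finset.expect_mul_expect, ← Finset.expect_sum_comm, ← hRQ]
    exact Finset.expect_le Finset.univ_nonempty fun x _ =>
      Finset.expect_le Finset.univ_nonempty fun y _ => hF₁ x y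
  have walkMean_eq (A : Matrix V V ℝ) : walkMean A F =
      ∑ i, walkMean A fun x y => (R i).indicator 1 x * (Q i).indicator 1 y := by
    rw [← walkMean_sum]
    exact congrArg _ (funext₂ hRQ)
  rw [walkMean_eq (S ^ k), Finset.mul_sum]
  calc _ ≤ _ := Finset.sum_le_sum fun i _ => walkMean_rectangle_le hS hS₀ hq hθ hθq (R i) (Q i)
    _ = θ * (k * (walkMean (S ^ (k + 2)) F / q) +
        ∑ i, (𝔼 x, (R i).indicator (1 : V → ℝ) x) * (𝔼 y, (Q i).indicator (1 : V → ℝ) y) + 1) := by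
      rw [walkMean_eq (S ^ (k + 2)), ← Finset.mul_sum, Finset.sum_add_distrib,
        Finset.sum_add_distrib, ← Finset.mul_sum, ← Finset.sum_div, Finset.sum_const,
        Finset.card_univ, Fintype.card_fin, nsmul_eq_mul, mul_one_div_cancel hN]
    _ ≤ _ := mul_le_mul_of_nonneg_left (by linarith) hθ.le

theorem walkMean_integral_pow_le [Nonempty V] {Ω : Type*} [MeasurableSpace Ω] {μ : Measure Ω}
    [IsProbabilityMeasure μ] {F : Ω → V → V → ℝ} (hN : 0 < N)
    (hF : ∀ ω, IsRectangleSum N (F ω)) (hF₁ : ∀ ω x y, F ω x y ≤ 1)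
    (hF_int : ∀ x y, Integrable (fun ω => F ω x y) μ) (hq : 0 < q)
    (hle : walkMean (S ^ (k + 2)) (fun x y => ∫ ω, F ω x y ∂μ) ≤ q) :
    walkMean (S ^ k) (fun x y => ∫ ω, F ω x y ∂μ) ^ (k + 2) ≤ q ^ k * N := by
  have hS₀_pow (m : ℕ) (i j : V) : 0 ≤ (S ^ m) i j := by
    simpa using pow_mulVec_nonneg hS₀
      (Pi.single_nonneg.mpr zero_le_one : 0 ≤ Pi.single j (1 : ℝ)) m i
  obtain ⟨θ, hθ, hθq⟩ : ∃ θ : ℝ, 0 < θ ∧ θ ^ (k + 2) = q ^ k * N :=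
    ⟨(q ^ k * N) ^ ((k + 2 : ℕ) : ℝ)⁻¹, by positivity,
      Real.rpow_inv_natCast_pow (by positivity) (by omega)⟩
  have linearized := integral_mono ((integrable_walkMean (S ^ k) hF_int).const_mul (k + 2 : ℝ))
    (((((integrable_walkMean (S ^ (k + 2)) hF_int).div_const q).const_mul (k : ℝ)).add
      (integrable_const (2 : ℝ))).const_mul θ)
    fun ω => (hF ω).walkMean_le hS hS₀ (hF₁ ω) hq hθ hθq
  simp only [Pi.add_apply] at linearized
  rw [integral_const_mul, integral_const_mul, integral_add
    (((integrable_walkMean (S ^ (k + 2)) hF_int).div_const q).const_mul _) (integrable_const _),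
    integral_const_mul, integral_div, walkMean_integral _ hF_int, walkMean_integral _ hF_int,
    integral_const, probReal_univ, one_smul] at linearized
  rw [← hθq]
  have nonneg := walkMean_nonneg (hS₀_pow k) (F := fun x y => ∫ ω, F ω x y ∂μ)
    fun x y => integral_nonneg fun ω => (hF ω).nonneg x y
  refine pow_le_pow_left₀ nonneg (le_of_mul_le_mul_left (a := (k + 2 : ℝ)) ?_ (by positivity)) _
  calc _ ≤ _ := linearized
    _ ≤ θ * (k * 1 + 2) := by gcongr; exact (div_le_one hq).mpr hle
    _ = (k + 2) * θ := by ring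

end RectangleBound

namespace CommTree

variable {X Y : Type} {T : CommTree X Y}

theorem isRectangleSum_indicator_mul_run {C : ℕ} {A : Set X} {B : Set Y}
    (hT : ∀ x ∈ A, ∀ y ∈ B, T.bitsSent x y ≤ C) :
    IsRectangleSum (2 ^ C) fun x y =>
      A.indicator (1 : X → ℝ) x * B.indicator (1 : Y → ℝ) y * (T.run x y).toNat := by
  induction T generalizing C A B with
  | aliceOut f =>
    convert (IsRectangleSum.indicator_mul_indicator {x ∈ A | f x} B).mono Nat.one_le_two_pow
      using 3 with x y
    by_cases hx : x ∈ A <;> by_cases hy : y ∈ B <;> cases hf : f x <;> simp [run, hx, hy, hf]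
  | bobOut g =>
    convert (IsRectangleSum.indicator_mul_indicator A {y ∈ B | g y}).mono Nat.one_le_two_pow
      using 3 with x y
    by_cases hx : x ∈ A <;> by_cases hy : y ∈ B <;> cases hg : g y <;> simp [run, hx, hy, hg]
  | aliceSend f next ih =>
    cases C with
    | zero =>
      convert IsRectangleSum.zero (X := X) (Y := Y) (2 ^ 0) using 3 with x y
      have : x ∈ A → y ∉ B := fun hx hy => Nat.not_succ_le_zero _ (hT x hx y hy)
      by_cases hx : x ∈ A <;> simp [hx, this]
    | succ C =>
      have next_le (b : Bool) : ∀ x ∈ {x ∈ A | f x = b}, ∀ y ∈ B, (next b).bitsSent x y ≤ C := by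
        rintro x ⟨hx, rfl⟩ y hy
        exact Nat.le_of_succ_le_succ (hT x hx y hy)
      convert (ih true (next_le true)).add (ih false (next_le false)) using 3 with x y
      · rw [pow_succ, mul_two]
      · by_cases hx : x ∈ A <;> cases hf : f x <;> simp [run, hx, hf]
  | bobSend g next ih =>
    cases C with
    | zero =>
      convert IsRectangleSum.zero (X := X) (Y := Y) (2 ^ 0) using 3 with x y
      have : x ∈ A → y ∉ B := fun hx hy => Nat.not_succ_le_zero _ (hT x hx y hy)
      by_cases hx : x ∈ A <;> simp [hx, this]
    | succ C =>
      have next_le (b : Bool) : ∀ x ∈ A, ∀ y ∈ {y ∈ B | g y = b}, (next b).bitsSent x y ≤ C := by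
        rintro x hx y ⟨hy, rfl⟩
        exact Nat.le_of_succ_le_succ (hT x hx y hy)
      convert (ih true (next_le true)).add (ih false (next_le false)) using 3 with x y
      · rw [pow_succ, mul_two]
      · by_cases hy : y ∈ B <;> cases hg : g y <;> simp [run, hy, hg]

theorem isRectangleSum_run {C : ℕ} (hT : ∀ x y, T.bitsSent x y ≤ C) :
    IsRectangleSum (2 ^ C) fun x y => ((T.run x y).toNat : ℝ) := by
  simpa using isRectangleSum_indicator_mul_run (A := Set.univ) (B := Set.univ)
    fun x _ y _ => hT x y

theorem run_add_run_of_bitsSent_eq_zero (hT : ∀ x y, T.bitsSent x y = 0) (x x' : X) (y y' : Y) :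
    ((T.run x y).toNat : ℝ) + (T.run x' y').toNat = (T.run x y').toNat + (T.run x' y).toNat := by
  cases T with
  | aliceOut f => rfl
  | bobOut g => exact add_comm _ _
  | aliceSend f next => exact absurd (hT x y) (Nat.succ_ne_zero _)
  | bobSend g next => exact absurd (hT x y) (Nat.succ_ne_zero _)

end CommTree

namespace RandProtocol

open Matrix

attribute [local instance] mΩ isProb

variable {X Y : Type} (P : RandProtocol X Y)

/-- The probability that the output on input `(x, y)` is `1`. -/
noncomputable def acceptProb (x : X) (y : Y) : ℝ :=
  P.μ.real {ω | (P.tree ω).run x y = true}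

theorem run_eq_indicator (x : X) (y : Y) :
    (fun ω => (((P.tree ω).run x y).toNat : ℝ)) =
      {ω | (P.tree ω).run x y = true}.indicator 1 := by
  funext ω
  cases h : (P.tree ω).run x y <;> simp [h]

theorem integrable_run (x : X) (y : Y) :
    Integrable (fun ω => (((P.tree ω).run x y).toNat : ℝ)) P.μ := by
  rw [run_eq_indicator]
  exact (integrable_const 1).indicator (P.measurableSet_run x y)

theorem integral_run (x : X) (y : Y) :
    ∫ ω, (((P.tree ω).run x y).toNat : ℝ) ∂P.μ = P.acceptProb x y := by
  rw [run_eq_indicator, integral_indicator_one (P.measurableSet_run x y), acceptProb]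

theorem acceptProb_nonneg (x : X) (y : Y) : 0 ≤ P.acceptProb x y :=
  measureReal_nonneg

theorem acceptProb_le_one (x : X) (y : Y) : P.acceptProb x y ≤ 1 :=
  measureReal_le_one

theorem errorProb_eq_acceptProb {f : X → Y → Bool} {x : X} {y : Y} (h : f x y = false) :
    P.errorProb f x y = P.acceptProb x y := by
  simp [acceptProb, errorProb, h]

theorem errorProb_eq_one_sub_acceptProb {f : X → Y → Bool} {x : X} {y : Y} (h : f x y = true) :
    P.errorProb f x y = 1 - P.acceptProb x y := by
  rw [acceptProb, ← probReal_compl_eq_one_sub (P.measurableSet_run x y), errorProb, h]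
  rfl

variable {P}

theorem bitsSent_le_of_cost_le {C : ℕ} (hC : P.cost ≤ C) (ω : P.Ω) (x : X) (y : Y) :
    (P.tree ω).bitsSent x y ≤ C := by
  simp only [cost, iSup_le_iff, Nat.cast_le] at hC
  exact hC ω x y

theorem acceptProb_add_acceptProb_of_cost_eq_zero (hP : P.cost = 0) (x x' : X) (y y' : Y) :
    P.acceptProb x y + P.acceptProb x' y' = P.acceptProb x y' + P.acceptProb x' y := by
  simp only [← integral_run]
  rw [← integral_add (P.integrable_run _ _) (P.integrable_run _ _),
    ← integral_add (P.integrable_run _ _) (P.integrable_run _ _)]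
  congr 1 with ω
  exact CommTree.run_add_run_of_bitsSent_eq_zero
    (fun x y => Nat.le_zero.mp (bitsSent_le_of_cost_le (by simp [hP]) ω x y)) x x' y y'

theorem walkMean_acceptProb_pow_le {C : ℕ} (hC : P.cost ≤ C) {V : Type*} [Fintype V]
    [DecidableEq V] [Nonempty V] {S : Matrix V V ℝ} (hS : S.IsSymm) (hS₀ : ∀ i j, 0 ≤ S i j)
    (φ : V → X) (ψ : V → Y) {k : ℕ} {q : ℝ} (hq : 0 < q)
    (hle : walkMean (S ^ (k + 2)) (fun x y => P.acceptProb (φ x) (ψ y)) ≤ q) :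
    walkMean (S ^ k) (fun x y => P.acceptProb (φ x) (ψ y)) ^ (k + 2) ≤ q ^ k * 2 ^ C := by
  simp only [← integral_run] at hle ⊢
  exact_mod_cast walkMean_integral_pow_le hS hS₀ (Nat.two_pow_pos C)
    (fun ω => (CommTree.isRectangleSum_run (bitsSent_le_of_cost_le hC ω)).comp φ ψ)
    (fun ω x y => by exact_mod_cast Bool.toNat_le _)
    (fun x y => P.integrable_run (φ x) (ψ y)) hq hle

end RandProtocol

section CubeWalk

open Matrix

variable {ι : Type*} [DecidableEq ι]

/-- The point of the cube that differs from `x` exactly in the coordinate `i`. -/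
def flipAt (i : ι) (x : ι → Bool) : ι → Bool :=
  Function.update x i !x i

theorem flipAt_apply_of_ne {i j : ι} (h : j ≠ i) (x : ι → Bool) : flipAt i x j = x j :=
  Function.update_of_ne h _ x

theorem flipAt_eq_comm {i : ι} {x y : ι → Bool} : flipAt i x = y ↔ flipAt i y = x := by
  constructor <;> rintro rfl <;> simp [flipAt]

variable [Fintype ι]

theorem hammingDist_flipAt {x z : ι → Bool} {i : ι} (h : x i = z i) :
    hammingDist x (flipAt i z) = hammingDist x z + 1 := by
  unfold hammingDist
  rw [← Finset.card_insert_of_notMem (a := i) (by simp [h])]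
  congr 1
  ext j
  simp only [Finset.mem_insert, Finset.mem_filter, Finset.mem_univ, true_and]
  by_cases hj : j = i
  · subst hj
    simp [flipAt, h]
  · simp [flipAt_apply_of_ne hj, hj]

theorem hammingDist_piecewise_compl {I : Finset ι} {x z : ι → Bool} (h : ∀ i ∉ I, x i = z i) :
    hammingDist x (I.piecewise z zᶜ) = hammingDist x z + Iᶜ.card := by
  unfold hammingDist
  rw [← Finset.card_union_of_disjoint]
  · congr 1
    ext i
    by_cases hi : i ∈ I <;> simp [hi, h]
  · exact Finset.disjoint_left.mpr fun i hi hI =>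
      (Finset.mem_filter.mp hi).2 (h i (Finset.mem_compl.mp hI))

/-- The transition matrix of the random walk on the cube that flips in each step a uniformly
random coordinate of `I`. -/
noncomputable def cubeWalk (I : Finset ι) : Matrix (ι → Bool) (ι → Bool) ℝ :=
  fun x y => 𝔼 i ∈ I, if flipAt i x = y then 1 else 0

theorem cubeWalk_isSymm (I : Finset ι) : (cubeWalk I).IsSymm := by
  ext x y
  simp only [transpose_apply, cubeWalk, flipAt_eq_comm]

theorem cubeWalk_mulVec (I : Finset ι) (f : (ι → Bool) → ℝ) (x : ι → Bool) :
    (cubeWalk I *ᵥ f) x = 𝔼 i ∈ I, f (flipAt i x) := by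
  simp only [mulVec, dotProduct, cubeWalk, Finset.expect_mul, ← Finset.expect_sum_comm, ite_mul,
    one_mul, zero_mul, Finset.sum_ite_eq, Finset.mem_univ, if_true]

variable {I : Finset ι} (hI : I.Nonempty)

include hI

theorem cubeWalk_mem_rowStochastic : cubeWalk I ∈ rowStochastic ℝ (ι → Bool) := by
  refine mem_rowStochastic.mpr ⟨fun x y => Finset.expect_nonneg fun i _ => by positivity, ?_⟩
  funext x
  rw [cubeWalk_mulVec]
  exact Finset.expect_const hI 1

theorem cubeWalk_mulVec_apply_le {G : (ι → Bool) → ℝ} (hG : ∀ z, G z ≤ 1) {δ : ℝ} (hδ : 0 ≤ δ)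
    {x z : ι → Bool} (hGδ : ∀ i ∈ I, x i = z i → G (flipAt i z) ≤ δ) :
    (cubeWalk I *ᵥ G) z ≤ δ + hammingDist x z / I.card := by
  have flip_le : ∀ i ∈ I, G (flipAt i z) ≤ δ + if x i ≠ z i then 1 else 0 := fun i hi => by
    split_ifs with hxz
    · linarith [hG (flipAt i z)]
    · linarith [hGδ i hi (not_not.mp hxz)]
  rw [cubeWalk_mulVec]
  calc _ ≤ 𝔼 i ∈ I, (δ + if x i ≠ z i then (1 : ℝ) else 0) := Finset.expect_le_expect flip_le
    _ = δ + (I.filter fun i => x i ≠ z i).card / I.card := by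
      rw [Finset.expect_add_distrib, Finset.expect_const hI, Finset.expect_eq_sum_div_card,
        Finset.sum_boole]
    _ ≤ δ + hammingDist x z / I.card := by
      gcongr
      exact Finset.card_le_card (Finset.filter_subset_filter _ (Finset.subset_univ I))

/- A walk of `m` steps ends at distance `m` unless some step undoes an earlier one; the `j`-th step
does so with probability at most `(j - 1) / #I`. -/
theorem cubeWalk_pow_mulVec_apply_le {G : (ι → Bool) → ℝ} (hG : ∀ z, G z ≤ 1) {δ : ℝ} (hδ : 0 ≤ δ)
    {x : ι → Bool} {m : ℕ}
    (hGδ : ∀ z, hammingDist x z = m → (∀ i ∉ I, x i = z i) → G z ≤ δ) :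
    (cubeWalk I ^ m *ᵥ G) x ≤ δ + m * (m - 1) / (2 * I.card) := by
  have : (0 : ℝ) < I.card := by exact_mod_cast hI.card_pos
  induction m generalizing G δ with
  | zero => simpa using hGδ x (hammingDist_self x) fun _ _ => rfl
  | succ m ih =>
    rw [pow_succ, ← mulVec_mulVec]
    refine (ih (G := cubeWalk I *ᵥ G) (δ := δ + m / I.card) (fun z => ?_) (by positivity)
      fun z hz hxz => ?_).trans_eq ?_
    · rw [cubeWalk_mulVec]
      exact Finset.expect_le hI fun i _ => hG _
    · rw [← hz]
      refine cubeWalk_mulVec_apply_le hI hG hδ fun i hi hxi => hGδ _ ?_ fun j hj => ?_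
      · rw [hammingDist_flipAt hxi, hz]
      · rw [hxz j hj, flipAt_apply_of_ne (ne_of_mem_of_not_mem hi hj).symm]
    · push_cast
      field_simp
      ring

theorem walkMean_cubeWalk_pow_le {F : (ι → Bool) → (ι → Bool) → ℝ} (hF : ∀ x z, F x z ≤ 1)
    {δ : ℝ} (hδ : 0 ≤ δ) {m : ℕ}
    (hFδ : ∀ x z, hammingDist x z = m → (∀ i ∉ I, x i = z i) → F x z ≤ δ) :
    walkMean (cubeWalk I ^ m) F ≤ δ + m * (m - 1) / (2 * I.card) :=
  Finset.expect_le Finset.univ_nonempty fun x _ =>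
    cubeWalk_pow_mulVec_apply_le hI (hF x) hδ (hFδ x)

theorem le_walkMean_cubeWalk_pow {F : (ι → Bool) → (ι → Bool) → ℝ} (hF : ∀ x z, 0 ≤ F x z)
    {δ : ℝ} (hδ : 0 ≤ δ) {m : ℕ}
    (hFδ : ∀ x z, hammingDist x z = m → (∀ i ∉ I, x i = z i) → 1 - δ ≤ F x z) :
    1 - (δ + m * (m - 1) / (2 * I.card)) ≤ walkMean (cubeWalk I ^ m) F := by
  have rejected := walkMean_cubeWalk_pow_le hI (F := fun x z => 1 - F x z)
    (fun x z => sub_le_self _ (hF x z)) hδ fun x z hxz hout => by linarith [hFδ x z hxz hout]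
  rw [walkMean_one_sub (one_vecMul_of_mem_rowStochastic
    (pow_mem (cubeWalk_mem_rowStochastic hI) m))] at rejected
  linarith

end CubeWalk

theorem mul_log_le_of_pow_le {m C : ℕ} {η : ℝ} (hη : 0 < η) (hη₁ : η ≤ 1 / 2) (hC : C ≠ 0)
    (h : (1 - η) ^ (m + 2) ≤ η ^ m * 2 ^ C) : m * Real.log ((1 - η) / η) ≤ 3 * C := by
  have hη' : 0 < 1 - η := by linarith
  have hC₁ : (1 : ℝ) ≤ C := by exact_mod_cast Nat.one_le_iff_ne_zero.mpr hC
  have log_le := Real.log_le_log (by positivity) h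
  rw [Real.log_mul (by positivity) (by positivity), Real.log_pow, Real.log_pow,
    Real.log_pow] at log_le
  have log_ge : -Real.log 2 ≤ Real.log (1 - η) := by
    rw [← Real.log_inv]
    exact Real.log_le_log (by norm_num) (by linarith)
  have log_two_le : Real.log 2 ≤ 1 := by linarith [Real.log_two_lt_d9]
  rw [Real.log_div hη'.ne' hη.ne']
  push_cast at log_le
  calc m * (Real.log (1 - η) - Real.log η) ≤ C * Real.log 2 - 2 * Real.log (1 - η) := by linarith
    _ ≤ C * 1 + 2 * 1 := by
      have := mul_le_mul_of_nonneg_left log_two_le (Nat.cast_nonneg (α := ℝ) C)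
      linarith
    _ ≤ 3 * C := by linarith

theorem two_mul_sq_lt_of_sq_le_mul {k n : ℕ} {δ : ℝ} (hk : 0 < k) (hδ : δ < 1 / 2)
    (h : (k : ℝ) ^ 2 ≤ δ * n) : 2 * k ^ 2 < n := by
  have hk₂ : (0 : ℝ) < k ^ 2 := by positivity
  have hn : (0 : ℝ) < n := (Nat.cast_nonneg n).lt_of_ne fun hn => by
    rw [← hn, mul_zero] at h
    exact hk₂.not_ge h
  have : 2 * (k : ℝ) ^ 2 < n := by nlinarith
  exact_mod_cast this

namespace RandProtocol

section HammingDistance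

open Matrix

variable {ι : Type} [Fintype ι]

/-- With error at most `δ`, the protocol tells pairs at Hamming distance `k` (accepted) from pairs
at distance `k + 2` (rejected). -/
structure SeparatesDist (P : RandProtocol (ι → Bool) (ι → Bool)) (k : ℕ) (δ : ℝ) : Prop where
  one_sub_le_acceptProb : ∀ x y, hammingDist x y = k → 1 - δ ≤ P.acceptProb x y
  acceptProb_le : ∀ x y, hammingDist x y = k + 2 → P.acceptProb x y ≤ δ

theorem separatesDist_of_hamPromise {n k : ℕ} {δ : ℝ}
    {P : RandProtocol (Fin n → Bool) (Fin n → Bool)}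
    (hP : ∀ x y, (x, y) ∈ hamPromise n k → P.errorProb (hamProblem n k) x y ≤ δ) :
    P.SeparatesDist k δ where
  one_sub_le_acceptProb x y h := by
    have error_le := hP x y (.inl h)
    rw [P.errorProb_eq_one_sub_acceptProb (by simp [hamProblem, h])] at error_le
    linarith
  acceptProb_le x y h := by
    have error_le := hP x y (.inr h)
    rwa [P.errorProb_eq_acceptProb (by simp [hamProblem, h])] at error_le

namespace SeparatesDist

variable {P : RandProtocol (ι → Bool) (ι → Bool)} {m k C : ℕ} {δ η : ℝ}

theorem cost_ne_zero (hP : P.SeparatesDist k δ) (hδ : δ < 1 / 2) (hk : k + 2 ≤ Fintype.card ι) :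
    P.cost ≠ 0 := by
  classical
  intro hP₀
  obtain ⟨D, -, hD⟩ := Finset.exists_subset_card_eq (s := Finset.univ) hk
  obtain ⟨A, hAD, hA⟩ := Finset.exists_subset_card_eq (s := D) (hD.symm ▸ Nat.le_add_right k 2)
  let ind (s : Finset ι) (i : ι) : Bool := decide (i ∈ s)
  have dist_ind {s t u : Finset ι} (h : ∀ i, i ∈ u ↔ (i ∈ s ↔ i ∉ t)) :
      hammingDist (ind s) (ind t) = u.card := by
    unfold hammingDist
    congr 1
    ext i
    by_cases hs : i ∈ s <;> by_cases ht : i ∈ t <;> simp [ind, h, hs, ht]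
  have accept := hP.one_sub_le_acceptProb (ind ∅) (ind A) ((dist_ind (by grind)).trans hA)
  have accept' := hP.one_sub_le_acceptProb (ind (D \ A)) (ind D) ((dist_ind (by grind)).trans hA)
  have reject := hP.acceptProb_le (ind ∅) (ind D) ((dist_ind (by grind)).trans hD)
  have reject' := hP.acceptProb_le (ind (D \ A)) (ind A) ((dist_ind (by grind)).trans hD)
  linarith [acceptProb_add_acceptProb_of_cost_eq_zero hP₀ (ind ∅) (ind (D \ A)) (ind A) (ind D)]

theorem ne_zero_of_cost_le (hP : P.SeparatesDist k δ) (hC : P.cost ≤ C) (hδ : δ < 1 / 2)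
    (hk₀ : 0 < k) (hk : (k : ℝ) ^ 2 ≤ δ * Fintype.card ι) : C ≠ 0 := by
  rintro rfl
  have hkn := two_mul_sq_lt_of_sq_le_mul hk₀ hδ hk
  exact hP.cost_ne_zero hδ (by nlinarith) (by simpa using hC)

/- Bob applies the protocol to his string complemented outside `I`; this adds `#Iᶜ` to the distance
from every string that agrees with his outside `I`. -/
theorem one_sub_pow_le [DecidableEq ι] {I : Finset ι} (hI : I.Nonempty)
    (hP : P.SeparatesDist (m + Iᶜ.card) δ)
    (hC : P.cost ≤ C) (hδ : 0 ≤ δ) (hη : 0 < η) (hη₁ : η ≤ 1)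
    (hle : δ + (m + 2) * (m + 1) / (2 * I.card) ≤ η) :
    (1 - η) ^ (m + 2) ≤ η ^ m * 2 ^ C := by
  have : (0 : ℝ) < I.card := by exact_mod_cast hI.card_pos
  have accept_le : walkMean (cubeWalk I ^ (m + 2))
      (fun x z => P.acceptProb x (I.piecewise z zᶜ)) ≤ η := by
    refine (walkMean_cubeWalk_pow_le hI (fun x z => P.acceptProb_le_one _ _) hδ
      fun x z hxz hout => hP.acceptProb_le _ _ ?_).trans (le_of_eq_of_le ?_ hle)
    · rw [hammingDist_piecewise_compl hout, hxz]; omega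
    · push_cast; ring
  have le_accept : 1 - η ≤ walkMean (cubeWalk I ^ m)
      (fun x z => P.acceptProb x (I.piecewise z zᶜ)) := by
    refine le_trans ?_ (le_walkMean_cubeWalk_pow hI (fun x z => P.acceptProb_nonneg _ _) hδ
      fun x z hxz hout => hP.one_sub_le_acceptProb _ _ ?_)
    · refine sub_le_sub_left (le_trans (add_le_add le_rfl ?_) hle) 1
      exact div_le_div_of_nonneg_right (by nlinarith [Nat.cast_nonneg (α := ℝ) m]) (by positivity)
    · rw [hammingDist_piecewise_compl hout, hxz]
  exact (pow_le_pow_left₀ (sub_nonneg.mpr hη₁) le_accept _).trans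
    (walkMean_acceptProb_pow_le hC (cubeWalk_isSymm I)
      (fun x y => nonneg_of_mem_rowStochastic (cubeWalk_mem_rowStochastic hI)) id
      (fun z => I.piecewise z zᶜ) hη accept_le)

theorem mul_log_le (hP : P.SeparatesDist k δ) (hC : P.cost ≤ C) (hδ : 0 < δ) (hm : m ≠ 0)
    (hmk : m ≤ k) (hk : (k : ℝ) ^ 2 ≤ δ * Fintype.card ι) (hη : δ * (1 + 6 * (m / k) ^ 2) ≤ η)
    (hη₁ : η ≤ 1 / 2) : m * Real.log ((1 - η) / η) ≤ 3 * C := by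
  classical
  have hm₀ : 0 < m := Nat.pos_of_ne_zero hm
  have hk₀ : 0 < k := hm₀.trans_le hmk
  have hδ₁ : δ < 1 / 2 := by
    have : 0 < δ * (6 * (m / k) ^ 2) := by positivity
    linarith
  have hn : 2 * k ^ 2 < Fintype.card ι := two_mul_sq_lt_of_sq_le_mul hk₀ hδ₁ hk
  have hn₀ : (0 : ℝ) < Fintype.card ι := by exact_mod_cast Nat.zero_lt_of_lt hn
  obtain ⟨I, -, hI⟩ := Finset.exists_subset_card_eq (s := (Finset.univ : Finset ι))
    (n := Fintype.card ι - (k - m)) (Nat.sub_le _ _)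
  have hkn : 2 * k ≤ Fintype.card ι := by nlinarith
  have hI_le : (Fintype.card ι : ℝ) ≤ 2 * I.card := by
    exact_mod_cast (by omega : Fintype.card ι ≤ 2 * I.card)
  obtain rfl : k = m + Iᶜ.card := by rw [Finset.card_compl]; omega
  have hη₀ : 0 < η := lt_of_lt_of_le (by positivity) hη
  have hle : δ + (m + 2) * (m + 1) / (2 * I.card) ≤ η := by
    have hm₁ : (1 : ℝ) ≤ m := by exact_mod_cast hm₀
    refine le_trans ?_ hη
    rw [mul_one_add]
    gcongr
    calc ((m : ℝ) + 2) * (m + 1) / (2 * I.card) ≤ 6 * m ^ 2 / Fintype.card ι :=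
          div_le_div₀ (by positivity) (by nlinarith) hn₀ hI_le
      _ ≤ 6 * m ^ 2 / ((m + Iᶜ.card : ℕ) ^ 2 / δ) := by
        gcongr
        exact (div_le_iff₀' hδ).mpr hk
      _ = _ := by field_simp
  exact mul_log_le_of_pow_le hη₀ hη₁ (hP.ne_zero_of_cost_le hC hδ₁ hk₀ hk)
    (hP.one_sub_pow_le (Finset.card_pos.mp (by omega)) hC hδ.le hη₀ (by linarith) hle)

theorem mul_log_inv_le_of_small (hP : P.SeparatesDist k δ) (hC : P.cost ≤ C) (hδ : 0 < δ)
    (hδ₁ : δ ≤ 1 / 64) (hk : (k : ℝ) ^ 2 ≤ δ * Fintype.card ι) :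
    k * Real.log (1 / δ) ≤ 6 * C := by
  rcases eq_or_ne k 0 with rfl | hk₀
  · simp
  have bound := hP.mul_log_le (η := 7 * δ) hC hδ hk₀ le_rfl hk
    (by rw [div_self (by exact_mod_cast hk₀)]; linarith) (by linarith)
  have log_le : Real.log (1 / δ) ≤ 2 * Real.log ((1 - 7 * δ) / (7 * δ)) := by
    rw [← Nat.cast_ofNat, ← Real.log_pow]
    refine Real.log_le_log (by positivity) ?_
    rw [div_pow, div_le_div_iff₀ hδ (by positivity)]
    nlinarith
  calc k * Real.log (1 / δ) ≤ k * (2 * Real.log ((1 - 7 * δ) / (7 * δ))) := by gcongr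
    _ ≤ 6 * C := by linarith

theorem min_mul_div_le {M : ℕ} (hP : P.SeparatesDist k δ) (hC : P.cost ≤ C) (hδ : 0 < δ)
    (hk : (k : ℝ) ^ 2 ≤ δ * Fintype.card ι) (hM : M ≠ 0) (hη : δ * (1 + 6 / M ^ 2) ≤ η)
    (hη₁ : η ≤ 1 / 2) : min 1 (Real.log ((1 - η) / η) / 6) * (k / M) ≤ C := by
  rcases Nat.eq_zero_or_pos k with rfl | hk₀
  · simp
  have hM₀ : 0 < M := Nat.pos_of_ne_zero hM
  have hη₀ : 0 < η := lt_of_lt_of_le (by positivity) hη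
  have hδ₁ : δ < 1 / 2 := by
    have : 0 < δ * (6 / M ^ 2) := by positivity
    linarith
  rcases eq_or_ne (k / M) 0 with hm | hm
  · have hkM : (k : ℝ) / M ≤ 1 := by
      rw [div_le_one (by positivity)]
      exact_mod_cast ((Nat.div_eq_zero_iff_lt hM₀).mp hm).le
    calc min 1 (Real.log ((1 - η) / η) / 6) * (k / M) ≤ 1 * (k / M) := by
          gcongr
          exact min_le_left _ _
      _ ≤ 1 := by rwa [one_mul]
      _ ≤ C := by exact_mod_cast Nat.one_le_iff_ne_zero.mpr (hP.ne_zero_of_cost_le hC hδ₁ hk₀ hk)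
  · have div_le : ((k / M : ℕ) : ℝ) / k ≤ 1 / M := by
      rw [div_le_div_iff₀ (by positivity) (by positivity), one_mul]
      exact_mod_cast Nat.div_mul_le_self k M
    have le_div : (k : ℝ) / M ≤ 2 * (k / M : ℕ) := by
      rw [div_le_iff₀' (by positivity)]
      have := Nat.lt_mul_div_succ k hM₀
      exact_mod_cast (by nlinarith [Nat.pos_of_ne_zero hm] : k ≤ M * (2 * (k / M)))
    have hL : 0 ≤ Real.log ((1 - η) / η) :=
      Real.log_nonneg ((one_le_div hη₀).mpr (by linarith))
    have hη_div : δ * (1 + 6 * ((k / M : ℕ) / k) ^ 2) ≤ η := by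
      refine le_trans ?_ hη
      rw [← mul_one_div (6 : ℝ), ← _root_.one_div_pow]
      gcongr
    have bound := hP.mul_log_le hC hδ hm (Nat.div_le_self k M) hk hη_div hη₁
    calc min 1 (Real.log ((1 - η) / η) / 6) * (k / M)
        ≤ Real.log ((1 - η) / η) / 6 * (2 * (k / M : ℕ)) := by
          gcongr
          exact min_le_right _ _
      _ ≤ C := by linarith

end SeparatesDist

theorem exists_mul_log_inv_le {δ₀ : ℝ} (hδ₀ : δ₀ < 1 / 2) :
    ∃ c : ℝ, 0 < c ∧ ∀ {ι : Type} [Fintype ι] {P : RandProtocol (ι → Bool) (ι → Bool)}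
      {k C : ℕ} {δ : ℝ}, P.SeparatesDist k δ → P.cost ≤ C → 0 < δ → δ ≤ δ₀ →
      (k : ℝ) ^ 2 ≤ δ * Fintype.card ι → c * (k * Real.log (1 / δ)) ≤ C := by
  obtain ⟨M, hMδ₀, hM⟩ : ∃ M : ℕ, δ₀ * (1 + 6 / M ^ 2) < 1 / 2 ∧ M ≠ 0 := by
    have lim : Filter.Tendsto (fun M : ℕ => δ₀ * (1 + 6 / (M : ℝ) ^ 2)) Filter.atTop (nhds δ₀) := by
      simpa using ((tendsto_const_div_pow (6 : ℝ) 2 two_ne_zero).comp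
        tendsto_natCast_atTop_atTop).const_add 1 |>.const_mul δ₀
    exact ((lim.eventually_lt_const hδ₀).and (Filter.eventually_ne_atTop 0)).exists
  let η := max (δ₀ * (1 + 6 / M ^ 2)) (1 / 4)
  have hη₀ : 0 < η := lt_max_of_lt_right (by norm_num)
  have hη₁ : η < 1 / 2 := max_lt hMδ₀ (by norm_num)
  have hL : 0 < Real.log ((1 - η) / η) := Real.log_pos ((one_lt_div hη₀).mpr (by linarith))
  have : 0 < Real.log 64 := Real.log_pos (by norm_num)
  let b := min 1 (Real.log ((1 - η) / η) / 6)
  have : 0 < M := Nat.pos_of_ne_zero hM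
  have hb : 0 < b := by positivity
  refine ⟨min (1 / 6) (b / (M * Real.log 64)), by positivity, ?_⟩
  intro ι _ P k C δ hP hC hδ hδδ₀ hk
  have hlog : 0 ≤ Real.log (1 / δ) := Real.log_nonneg ((one_le_div hδ).mpr (by linarith))
  rcases le_or_gt δ (1 / 64) with hδ' | hδ'
  · have small := hP.mul_log_inv_le_of_small hC hδ hδ' hk
    calc _ ≤ 1 / 6 * (k * Real.log (1 / δ)) := by
          gcongr
          exact min_le_left _ _
      _ ≤ C := by linarith
  · have hη : δ * (1 + 6 / M ^ 2) ≤ η := le_max_of_le_left (by gcongr)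
    have log_le : Real.log (1 / δ) ≤ Real.log 64 :=
      Real.log_le_log (by positivity) ((one_div_le hδ (by norm_num)).mpr hδ'.le)
    calc _ ≤ b / (M * Real.log 64) * (k * Real.log 64) := by
          gcongr
          exact min_le_right _ _
      _ = b * (k / M) := by field_simp
      _ ≤ C := hP.min_mul_div_le hC hδ hk hM hη hη₁.le

end HammingDistance

end RandProtocol

section RandCC

variable {X Y : Type} {D D' : Set (X × Y)} {δ : ℝ} {f : X → Y → Bool}

theorem randCCOn_mono (h : D ⊆ D') : randCCOn D δ f ≤ randCCOn D' δ f :=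
  le_iInf₂ fun P hP => iInf₂_le P fun x y hxy => hP x y (h hxy)

theorem ofReal_le_randCCOn {v : ℝ}
    (h : ∀ P : RandProtocol X Y, (∀ x y, (x, y) ∈ D → P.errorProb f x y ≤ δ) →
      ∀ C : ℕ, P.cost ≤ C → v ≤ C) :
    ENNReal.ofReal v ≤ (randCCOn D δ f : ENNReal) := by
  have ceil_le : (⌈v⌉₊ : ℕ∞) ≤ randCCOn D δ f := le_iInf₂ fun P hP => by
    obtain hcost | ⟨C, hC⟩ := (eq_or_ne P.cost ⊤).imp_right ENat.ne_top_iff_exists.mp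
    · exact hcost ▸ le_top
    · rw [← hC, Nat.cast_le]
      exact Nat.ceil_le.mpr (h P hP C hC.ge)
  calc ENNReal.ofReal v ≤ ENNReal.ofReal ⌈v⌉₊ := ENNReal.ofReal_le_ofReal (Nat.le_ceil v)
    _ = ((⌈v⌉₊ : ℕ∞) : ENNReal) := by simp
    _ ≤ _ := ENat.toENNReal_mono ceil_le

end RandCC

theorem theorem4 (δ₀ : ℝ) (hδ₀ : δ₀ < 1 / 2) :
    ∃ c : ℝ, 0 < c ∧
      ∀ (n k : ℕ) (δ : ℝ), 0 < δ → δ ≤ δ₀ → (k : ℝ) ^ 2 ≤ δ * n →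
        ENNReal.ofReal (c * (k * Real.log (1 / δ))) ≤ (randCC δ (hamProblem n k) : ENNReal) ∧
        ENNReal.ofReal (c * (k * Real.log (1 / δ))) ≤
          (randCCOn (hamPromise n k) δ (hamProblem n k) : ENNReal) := by
  obtain ⟨c, hc, cost_ge⟩ := RandProtocol.exists_mul_log_inv_le hδ₀
  refine ⟨c, hc, fun n k δ hδ hδδ₀ hk => ?_⟩
  have promise : ENNReal.ofReal (c * (k * Real.log (1 / δ))) ≤
      (randCCOn (hamPromise n k) δ (hamProblem n k) : ENNReal) :=
    ofReal_le_randCCOn fun P hP C hC => cost_ge (RandProtocol.separatesDist_of_hamPromise hP) hC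
      hδ hδδ₀ (by rwa [Fintype.card_fin])
  exact ⟨promise.trans (ENat.toENNReal_mono (randCCOn_mono (Set.subset_univ _))), promise⟩
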